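/- All graphs are finite and simple. For a graph $G$ and an injective map $p\colon V(G)\to\mathbb{R}^2$, consider the straight-line drawing of $G$ that places each vertex $v$ at $p(v)$ and draws each edge $uv$ as the segment $\overline{p(u)p(v)}$. The \emph{outer face} of the drawing is the unbounded connected component of the complement of the union of all vertices and edges of the drawing. The map $p$ is an \emph{outside-obstacle representation} (OOR) of $G$ if any two distinct vertices $u,v$ are adjacent in $G$ if and only if $\overline{p(u)p(v)}$ does not meet the outer face. An OOR is \emph{convex} if the points $p(v)$ are in (strictly) convex position, and \emph{regular} if they are the vertices of a regular $n$-gon, where $n=|V(G)|$ (a single point for $n=1$, two distinct points for $n=2$). Let $W_6$ be the wheel on six vertices, that is, a $5$-cycle together with a hub adjacent to all its vertices. Proposition. Let $G$ be a graph with at most six vertices. Then $G$ has a regular OOR if and only if $G$ is not isomorphic to $W_6$. Moreover, a graph isomorphic to $W_6$ has no convex OOR at all. Finally, $W_6$ is isomorphic to $K_6-E(C_5)$, the complete graph on six vertices minus the edge set of a simple $5$-cycle. -/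

import Mathlib

/-- The point set covered by the straight-line drawing of `G` in the plane `ℂ` in which the vertex
`v` is placed at the point `p v`: all vertices and all edges, drawn as closed line segments. -/
def drawing {V : Type*} (G : SimpleGraph V) (p : V → ℂ) : Set ℂ :=
  Set.range p ∪ ⋃ (u : V) (v : V) (_ : G.Adj u v), segment ℝ (p u) (p v)

/-- The outer face of the drawing: the unbounded connected component of its complement
(the complement of a bounded set in the plane has exactly one unbounded component). -/
def outerFace {V : Type*} (G : SimpleGraph V) (p : V → ℂ) : Set ℂ :=
  {x | x ∈ (drawing G p)ᶜ ∧ ¬ Bornology.IsBounded (connectedComponentIn (drawing G p)ᶜ x)}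

/-- The placement `p` is an outside-obstacle representation (OOR) of `G`: distinct vertices are
placed at distinct points, and `G` is the visibility graph of these points with respect to the
single obstacle that consists of the whole outer face. That is, two distinct vertices are adjacent
exactly if the line segment between them does not meet the outer face. -/
def IsOOR {V : Type*} (G : SimpleGraph V) (p : V → ℂ) : Prop :=
  Function.Injective p ∧
    ∀ u v : V, u ≠ v → (G.Adj u v ↔ Disjoint (segment ℝ (p u) (p v)) (outerFace G p))

/-- `p` places the elements of `V` bijectively on the vertices of a regular `n`-gon, where `n` is
the number of elements of `V` (a single point for `n = 1`, two distinct points for `n = 2`). -/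
def IsRegularPolygonPlacement {V : Type*} [Fintype V] (p : V → ℂ) : Prop :=
  ∃ c z : ℂ, z ≠ 0 ∧ ∃ σ : V ≃ Fin (Fintype.card V), ∀ v : V,
    p v = c + z * Complex.exp
      (2 * (Real.pi : ℂ) * Complex.I * ((σ v : ℕ) : ℂ) / (Fintype.card V : ℂ))

/-- `G` has a convex OOR: an OOR whose vertices are in convex position. -/
def HasConvexOOR {V : Type*} (G : SimpleGraph V) : Prop :=
  ∃ p : V → ℂ, IsOOR G p ∧ ConvexIndependent ℝ p

/-- `G` has a regular OOR: an OOR whose vertices form a regular polygon. -/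
def HasRegularOOR {V : Type*} [Fintype V] (G : SimpleGraph V) : Prop :=
  ∃ p : V → ℂ, IsOOR G p ∧ IsRegularPolygonPlacement p

/-- The wheel graph `W_n` on `n ≥ 4` vertices: a cycle with `n - 1` vertices (the elements
`some i`), together with a hub (the element `none`) that is adjacent to all of them. -/
def wheelGraph (n : ℕ) : SimpleGraph (Option (Fin (n - 1))) where
  Adj
    | none, none => False
    | none, some _ => True
    | some _, none => True
    | some i, some j => (SimpleGraph.cycleGraph (n - 1)).Adj i j
  symm := ⟨by
    rintro (_ | i) (_ | j) h
    · exact h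
    · trivial
    · trivial
    · exact SimpleGraph.Adj.symm h⟩
  loopless := ⟨by
    rintro (_ | i) h
    · exact h
    · exact SimpleGraph.irrefl _ h⟩

/-- The graph `K_n - E(C_k)` for `k ≤ n`: the complete graph on `n` vertices without the edges of
a simple cycle through the first `k` of them. -/
def completeMinusCycle (n k : ℕ) (h : k ≤ n) : SimpleGraph (Fin n) :=
  ⊤ \ (SimpleGraph.cycleGraph k).map (Fin.castLEEmb h)

/-! An edge is part of the drawing and so never meets the outer face. A placement is therefore an
OOR exactly when every non-edge meets the outer face.

Existence. In a regular polygon, let `ij` be a non-edge such that, on one side of it, no segment at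
`i` is an edge (a fan). Near `i` only edges at `i` are present, so a point of `ij` close to `i`
escapes to infinity on the empty side (`not_disjoint_segment_of_fan`). This turns the problem into a
Boolean condition on the non-adjacency relation. With at most three vertices it always holds. For
four, five and six vertices a kernel computation finds a good placement, except when the non-edges
form a 5-cycle plus an isolated vertex. Since the 5-cycle is self-complementary, that exceptional
graph is `W_6`. In the hexagon the long diagonal `14` has one more way out: if no edge joins `012`
to `345`, its midpoint escapes between the two halves (`not_disjoint_segment_of_split`).

Non-existence. In a convex OOR of `W_6`, sort the rim by angle around the hub `O`. Some non-adjacent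
rim pair `u`, `v` has each angular gap between them spanned by a rim edge `ab` lying between them
(`wheel_chord_search`). By convexity the chord `uv` stays on the side of `ab` that contains `O`, so
each of its points lies in a triangle `Oab` whose sides are all edges
(`notMem_outerFace_of_mem_triangle`). The non-edge `uv` thus misses the outer face, a contradiction.
Regular placements are convex, so `W_6` has no regular OOR either. -/

/-! ### Drawings and the outer face -/

/-- The ray is a connected unbounded part of the complement, so the component of its starting point
is unbounded. -/
theorem mem_outerFace_of_ray {V : Type*} {G : SimpleGraph V} {p : V → ℂ} {x d : ℂ} (hd : d ≠ 0)
    (h : ∀ t : ℝ, 0 ≤ t → x + t • d ∉ drawing G p) : x ∈ outerFace G p := by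
  have hx : x ∈ (drawing G p)ᶜ := by simpa using h 0 le_rfl
  refine ⟨hx, fun hb => ?_⟩
  have hpre : IsPreconnected ((fun t : ℝ => x + t • d) '' Set.Ici 0) :=
    isPreconnected_Ici.image _ (by fun_prop)
  have hsub := hpre.subset_connectedComponentIn (x := x) (F := (drawing G p)ᶜ)
    ⟨0, by simp, by simp⟩ (by rintro _ ⟨t, ht, rfl⟩; exact h t ht)
  obtain ⟨C, hC⟩ := (hb.subset hsub).exists_norm_le
  have hd' : 0 < ‖d‖ := norm_pos_iff.mpr hd
  have hC0 : 0 ≤ C := (norm_nonneg _).trans (hC x ⟨0, by simp, by simp⟩)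
  have ht : 0 ≤ (C + ‖x‖ + 1) / ‖d‖ := by positivity
  have h1 := hC _ ⟨(C + ‖x‖ + 1) / ‖d‖, ht, rfl⟩
  have h2 : ‖((C + ‖x‖ + 1) / ‖d‖) • d‖ = C + ‖x‖ + 1 := by
    rw [norm_smul, Real.norm_of_nonneg ht, div_mul_cancel₀ _ hd'.ne']
  have h3 := norm_sub_norm_le (((C + ‖x‖ + 1) / ‖d‖) • d) (-x)
  rw [sub_neg_eq_add, add_comm _ x, norm_neg, h2] at h3
  linarith

theorem mem_drawing_iff {V : Type*} {G : SimpleGraph V} {p : V → ℂ} {x : ℂ} :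
    x ∈ drawing G p ↔ ∃ u v, (u = v ∨ G.Adj u v) ∧ x ∈ segment ℝ (p u) (p v) := by
  simp only [drawing, Set.mem_union, Set.mem_range, Set.mem_iUnion]
  constructor
  · rintro (⟨u, rfl⟩ | ⟨u, v, h, hx⟩)
    · exact ⟨u, u, Or.inl rfl, left_mem_segment _ _ _⟩
    · exact ⟨u, v, Or.inr h, hx⟩
  · rintro ⟨u, v, rfl | h, hx⟩
    · rw [segment_same] at hx
      exact Or.inl ⟨u, hx.symm⟩
    · exact Or.inr ⟨u, v, h, hx⟩

theorem disjoint_outerFace_of_adj {V : Type*} {G : SimpleGraph V} {p : V → ℂ} {u v : V}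
    (h : G.Adj u v) : Disjoint (segment ℝ (p u) (p v)) (outerFace G p) :=
  Set.disjoint_left.mpr fun _ hx hx' => hx'.1 (mem_drawing_iff.mpr ⟨u, v, Or.inr h, hx⟩)

theorem IsOOR.comp_iso {V W : Type*} {G : SimpleGraph V} {K : SimpleGraph W} {q : W → ℂ}
    (hq : IsOOR K q) (e : G ≃g K) : IsOOR G (q ∘ e) := by
  have hd : drawing G (q ∘ e) = drawing K q := by
    ext x
    rw [mem_drawing_iff, mem_drawing_iff]
    constructor
    · rintro ⟨u, v, h, hx⟩
      exact ⟨e u, e v, h.imp (congrArg e) e.map_adj_iff.mpr, hx⟩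
    · rintro ⟨u, v, h, hx⟩
      obtain ⟨u, rfl⟩ := e.surjective u
      obtain ⟨v, rfl⟩ := e.surjective v
      exact ⟨u, v, h.imp (fun h => e.injective h) e.map_adj_iff.mp, hx⟩
  have ho : outerFace G (q ∘ e) = outerFace K q := by simp only [outerFace, hd]
  refine ⟨hq.1.comp e.injective, fun u v huv => ?_⟩
  rw [ho, ← e.map_adj_iff]
  exact hq.2 _ _ fun h => huv (e.injective h)

/-! ### Coordinates of the regular polygon -/

/-- The vertices of the regular `n`-gon that is inscribed in the unit circle and contains `1`. -/
noncomputable def polygonVertex (n : ℕ) (k : Fin n) : ℂ :=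
  Complex.exp (2 * (Real.pi : ℂ) * Complex.I * ((k : ℕ) : ℂ) / (n : ℂ))

section Polygon

variable {n : ℕ}

theorem polygonVertex_eq (k : Fin n) :
    polygonVertex n k = Complex.exp ((2 * (Real.pi * k / n) : ℝ) * Complex.I) := by
  unfold polygonVertex
  congr 1
  push_cast
  ring

theorem polygonVertex_re (k : Fin n) :
    (polygonVertex n k).re = Real.cos (2 * (Real.pi * k / n)) := by
  rw [polygonVertex_eq, Complex.exp_ofReal_mul_I_re]

theorem polygonVertex_im (k : Fin n) :
    (polygonVertex n k).im = Real.sin (2 * (Real.pi * k / n)) := by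
  rw [polygonVertex_eq, Complex.exp_ofReal_mul_I_im]

theorem norm_polygonVertex (k : Fin n) : ‖polygonVertex n k‖ = 1 := by
  rw [polygonVertex_eq, Complex.norm_exp_ofReal_mul_I]

theorem polygonVertex_ne_zero (k : Fin n) : polygonVertex n k ≠ 0 := by
  rw [← norm_pos_iff, norm_polygonVertex]; exact one_pos

theorem polygonVertex_zero [NeZero n] : polygonVertex n 0 = 1 := by
  simp [polygonVertex]

/-- Indices add modulo `n`, so multiplication by `polygonVertex n i` is the rotation that moves the
vertex `1` to vertex `i`. It lets later arguments assume that the vertex of interest is `1`. -/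
theorem polygonVertex_add [NeZero n] (i k : Fin n) :
    polygonVertex n (i + k) = polygonVertex n i * polygonVertex n k := by
  have hn : (n : ℂ) ≠ 0 := Nat.cast_ne_zero.mpr (NeZero.ne n)
  unfold polygonVertex
  rw [← Complex.exp_add, Complex.exp_eq_exp_iff_exists_int, Fin.val_add]
  obtain ⟨q, hq⟩ : ∃ q : ℕ, n * q + ((i : ℕ) + k) % n = i + k := ⟨_, Nat.div_add_mod _ _⟩
  refine ⟨-(q : ℤ), ?_⟩
  have h := congrArg (Nat.cast : ℕ → ℂ) hq
  push_cast at h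
  have h2 : ((((i : ℕ) + k) % n : ℕ) : ℂ) = i + k - n * q := by
    rw [← h]; ring
  rw [h2]
  push_cast
  field_simp
  ring

theorem half_angle_mem (k : Fin n) (hk : (k : ℕ) ≠ 0) :
    0 < Real.pi * k / n ∧ Real.pi * k / n < Real.pi := by
  have hn : (0 : ℝ) < n := by exact_mod_cast k.pos
  have hk' : (0 : ℝ) < k := by exact_mod_cast Nat.pos_of_ne_zero hk
  have hkn : ((k : ℕ) : ℝ) < n := by exact_mod_cast k.2
  refine ⟨by positivity, ?_⟩
  rw [div_lt_iff₀ hn]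
  exact mul_lt_mul_of_pos_left hkn Real.pi_pos

theorem polygonVertex_re_lt_one (k : Fin n) (hk : (k : ℕ) ≠ 0) : (polygonVertex n k).re < 1 := by
  obtain ⟨h0, h1⟩ := half_angle_mem k hk
  rw [polygonVertex_re, Real.cos_two_mul']
  have := Real.sin_pos_of_pos_of_lt_pi h0 h1
  nlinarith [Real.sin_sq_add_cos_sq (Real.pi * k / n)]

theorem polygonVertex_injective : Function.Injective (polygonVertex n) := by
  intro i j h
  have : NeZero n := ⟨by have := i.2; omega⟩
  have h1 : polygonVertex n j * polygonVertex n (i - j) = polygonVertex n j * 1 := by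
    rw [← polygonVertex_add, mul_one, add_sub_cancel, h]
  have h2 := mul_left_cancel₀ (polygonVertex_ne_zero j) h1
  by_contra hij
  have := polygonVertex_re_lt_one (i - j) (by
    rw [Ne, Fin.val_eq_zero_iff, sub_eq_zero]; exact hij)
  rw [h2] at this
  simp at this

/-- Seen from the polygon vertex `1`, the slopes of the diagonals decrease. -/
theorem polygonVertex_slope_lt {j k : Fin n} (hj : (j : ℕ) ≠ 0) (hjk : j < k) :
    (polygonVertex n k).im * (1 - (polygonVertex n j).re) <
      (polygonVertex n j).im * (1 - (polygonVertex n k).re) := by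
  obtain ⟨h0, h1⟩ := half_angle_mem j hj
  obtain ⟨h2, h3⟩ := half_angle_mem k (by have : (j : ℕ) < k := hjk; omega)
  have hlt : Real.pi * j / n < Real.pi * k / n := by
    have hn : (0 : ℝ) < n := by exact_mod_cast j.pos
    have : ((j : ℕ) : ℝ) < k := by exact_mod_cast hjk
    have := Real.pi_pos
    gcongr
  simp only [polygonVertex_re, polygonVertex_im]
  generalize Real.pi * j / n = a at *
  generalize Real.pi * k / n = b at *
  have ha := Real.sin_pos_of_pos_of_lt_pi h0 h1
  have hb := Real.sin_pos_of_pos_of_lt_pi h2 h3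
  have hab := Real.sin_pos_of_pos_of_lt_pi (sub_pos.mpr hlt) (by linarith)
  -- Both sides are twice the area of the triangle with vertices `1`, `exp (2ia)`, `exp (2ib)`,
  -- inscribed in the unit circle with angles `a`, `b - a`, `π - b`.
  have key : Real.sin (2 * a) * (1 - Real.cos (2 * b)) - Real.sin (2 * b) * (1 - Real.cos (2 * a))
      = 4 * (Real.sin a * Real.sin b * Real.sin (b - a)) := by
    rw [Real.sin_two_mul, Real.sin_two_mul, Real.cos_two_mul', Real.cos_two_mul', Real.sin_sub,
      Real.cos_sq', Real.cos_sq']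
    ring
  have : 0 < Real.sin a * Real.sin b * Real.sin (b - a) := by positivity
  linarith

end Polygon

/-! ### Non-edges that escape at an endpoint -/

section Fan

variable {n : ℕ} [NeZero n]

/-- The vertical line of real part `r` cuts the vertex `1` off from all others, so only edges at
that vertex can reach it. -/
theorem exists_re_bound (n : ℕ) [NeZero n] :
    ∃ r : ℝ, r < 1 ∧ ∀ j : Fin n, j ≠ 0 → (polygonVertex n j).re < r := by
  have h : ∀ᶠ r : ℝ in nhdsWithin 1 (Set.Iio 1),
      ∀ j : Fin n, j ≠ 0 → (polygonVertex n j).re < r := by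
    rw [Filter.eventually_all]
    intro j
    by_cases hj : j = 0
    · simp [hj]
    · have hlt := polygonVertex_re_lt_one j (Fin.val_ne_zero_iff.mpr hj)
      exact (eventually_nhdsWithin_of_eventually_nhds (lt_mem_nhds hlt)).mono fun r hr _ => hr
  obtain ⟨r, h1, h2⟩ :=
    ((eventually_mem_nhdsWithin : ∀ᶠ r : ℝ in nhdsWithin 1 (Set.Iio 1), r ∈ Set.Iio 1).and h).exists
  exact ⟨r, h1, h2⟩

/-- After rotating `i` to `1`, the point of the diagonal on the separating line is moved along that
line, upwards for `s > 0` and downwards for `s < 0`. An edge in the way must end at `i`, and its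
slope there lies weakly on the `s` side of the diagonal. The inequality is not strict because the
starting point excludes the diagonal itself. -/
theorem not_disjoint_segment_of_slope {G : SimpleGraph (Fin n)} {i k : Fin n} (hk : k ≠ 0) (s : ℝ)
    (hs : s ≠ 0)
    (h : ∀ j : Fin n, j ≠ 0 →
      0 ≤ s * ((polygonVertex n j).im * (1 - (polygonVertex n k).re) -
        (polygonVertex n k).im * (1 - (polygonVertex n j).re)) → ¬ G.Adj i (i + j)) :
    ¬ Disjoint (segment ℝ (polygonVertex n i) (polygonVertex n (i + k)))
      (outerFace G (polygonVertex n)) := by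
  obtain ⟨r, hr1, hr⟩ := exists_re_bound n
  have hrk := hr k hk
  -- The weight for which `1 + l * (polygonVertex n k - 1)` has real part `r`.
  set l : ℝ := (1 - r) / (1 - (polygonVertex n k).re) with hl
  have hpos : 0 < 1 - (polygonVertex n k).re := by linarith
  have hl0 : 0 < l := div_pos (by linarith) hpos
  have hl1 : l ≤ 1 := by rw [hl, div_le_one hpos]; linarith
  have hlm : l * (1 - (polygonVertex n k).re) = 1 - r := div_mul_cancel₀ _ hpos.ne'
  have hpi := polygonVertex_ne_zero i
  -- An edge from `i` to `i + j` does not meet the ray; `a` is its parameter on the line of real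
  -- part `r`.
  have key : ∀ (t a : ℝ) (j : Fin n), 0 ≤ t → j ≠ 0 → G.Adj i (i + j) →
      r = (1 - a) + a * (polygonVertex n j).re →
      l * (polygonVertex n k).im + t * s ≠ a * (polygonVertex n j).im := by
    intro t a j ht hj hadj h1 h2
    refine h j hj ?_ hadj
    have hrj := hr j hj
    have ha : 0 < a := by
      by_contra hneg
      nlinarith
    have e : (l * a) * (s * ((polygonVertex n j).im * (1 - (polygonVertex n k).re) -
        (polygonVertex n k).im * (1 - (polygonVertex n j).re))) = s ^ 2 * t * (1 - r) := by
      have h3 : a * (1 - (polygonVertex n j).re) = 1 - r := by linarith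
      linear_combination (s * a * (polygonVertex n j).im) * hlm
        - (s * l * (polygonVertex n k).im) * h3 - s * (1 - r) * h2
    have h4 : 0 ≤ s ^ 2 * t * (1 - r) := by
      have : 0 ≤ 1 - r := by linarith
      positivity
    rw [← e] at h4
    exact nonneg_of_mul_nonneg_right h4 (mul_pos hl0 ha)
  rw [Set.not_disjoint_iff]
  refine ⟨polygonVertex n i * (1 + l * (polygonVertex n k - 1)),
    ⟨1 - l, l, by linarith, hl0.le, by ring, ?_⟩,
    mem_outerFace_of_ray (d := s * Complex.I * polygonVertex n i) ?_ ?_⟩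
  · rw [polygonVertex_add, Complex.real_smul, Complex.real_smul]
    push_cast
    ring
  · simp [hs, hpi, Complex.I_ne_zero]
  · intro t ht hmem
    obtain ⟨u, v, huv, α, β, hα, hβ, hαβ, hx⟩ := mem_drawing_iff.mp hmem
    obtain ⟨a, rfl⟩ : ∃ a, u = i + a := ⟨u - i, by rw [add_sub_cancel]⟩
    obtain ⟨b, rfl⟩ : ∃ b, v = i + b := ⟨v - i, by rw [add_sub_cancel]⟩
    have hx' : (α : ℂ) * polygonVertex n a + β * polygonVertex n b =
        1 + l * (polygonVertex n k - 1) + t * s * Complex.I := by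
      apply mul_left_cancel₀ hpi
      rw [polygonVertex_add, polygonVertex_add, Complex.real_smul, Complex.real_smul,
        Complex.real_smul] at hx
      linear_combination hx
    have hre := congrArg Complex.re hx'
    have him := congrArg Complex.im hx'
    simp at hre him
    have hre' : α * (polygonVertex n a).re + β * (polygonVertex n b).re = r := by linarith
    by_cases ha : a = 0
    · subst ha
      by_cases hb : b = 0
      · subst hb
        simp only [polygonVertex_zero, Complex.one_re] at hre'
        linarith
      · simp only [polygonVertex_zero, Complex.one_re, Complex.one_im] at hre' him
        have hadj := huv.resolve_left fun hab => hb (add_left_cancel hab).symm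
        rw [add_zero] at hadj
        refine key t β b ht hb hadj ?_ ?_
        · linarith
        · linarith
    · have hra := hr a ha
      by_cases hb : b = 0
      · subst hb
        simp only [polygonVertex_zero, Complex.one_re, Complex.one_im] at hre' him
        have hadj := (huv.resolve_left fun hab => ha (add_left_cancel hab)).symm
        rw [add_zero] at hadj
        refine key t α a ht ha hadj ?_ ?_
        · linarith
        · linarith
      -- Neither end is `i`: both real parts are below `r`, so no convex combination of them equals
      -- `r`.
      · have hrb := hr b hb
        rcases hα.eq_or_lt with rfl | hα'
        · have : β = 1 := by linarith
          subst this
          linarith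
        · nlinarith [mul_lt_mul_of_pos_left hra hα', mul_le_mul_of_nonneg_left hrb.le hβ]

/-- A diagonal of the regular polygon meets the outer face if none of the segments at one of its
endpoints that lie on one side of the diagonal, nor the diagonal itself, is an edge. -/
theorem not_disjoint_segment_of_fan {G : SimpleGraph (Fin n)} {i k : Fin n} (hk : k ≠ 0)
    (h : (∀ j : Fin n, j ≠ 0 → j ≤ k → ¬ G.Adj i (i + j)) ∨
      ∀ j : Fin n, k ≤ j → ¬ G.Adj i (i + j)) :
    ¬ Disjoint (segment ℝ (polygonVertex n i) (polygonVertex n (i + k)))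
      (outerFace G (polygonVertex n)) := by
  rcases h with h | h
  · refine not_disjoint_segment_of_slope hk 1 one_ne_zero fun j hj hs => h j hj ?_
    by_contra hlt
    have := polygonVertex_slope_lt (Fin.val_ne_zero_iff.mpr hk) (not_le.mp hlt)
    linarith
  · refine not_disjoint_segment_of_slope hk (-1) (by norm_num) fun j hj hs => h j ?_
    by_contra hlt
    have := polygonVertex_slope_lt (Fin.val_ne_zero_iff.mpr hj) (not_le.mp hlt)
    linarith

end Fan

/-! ### Separating the two halves of the hexagon -/

theorem re_polygonVertex_zero_mul_conj_one :
    (polygonVertex 6 0 * (starRingEnd ℂ) (polygonVertex 6 1)).re = 1 / 2 := by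
  rw [polygonVertex_zero, one_mul, Complex.conj_re, polygonVertex_re, ← Real.cos_pi_div_three]
  congr 1
  norm_num
  ring

/-- In the regular hexagon, the diagonal `14` meets the outer face if no edge joins one of the
vertices `0, 1, 2` to one of the vertices `3, 4, 5`. -/
theorem not_disjoint_segment_of_split {G : SimpleGraph (Fin 6)}
    (h : ∀ i j : Fin 6, i < 3 → 3 ≤ j → ¬ G.Adj i j) :
    ¬ Disjoint (segment ℝ (polygonVertex 6 1) (polygonVertex 6 4))
      (outerFace G (polygonVertex 6)) := by
  have e3 : polygonVertex 6 3 = -1 := by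
    unfold polygonVertex
    rw [← Complex.exp_pi_mul_I]
    congr 1
    norm_num
    ring
  have hneg : ∀ i : Fin 6, polygonVertex 6 (3 + i) = - polygonVertex 6 i := by
    intro i
    rw [polygonVertex_add, e3, neg_one_mul]
  -- The inner product with vertex `1`: positive on `0, 1, 2`, negative on `3, 4, 5`. Its zero line
  -- passes through the centre, the midpoint of `14`, and meets no edge.
  set f : ℂ → ℝ := fun z => (z * (starRingEnd ℂ) (polygonVertex 6 1)).re with hf
  have hfneg : ∀ z, f (-z) = - f z := fun z => by simp only [hf, neg_mul, Complex.neg_re]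
  have h0 : 0 < f (polygonVertex 6 0) := by
    simp only [hf]; rw [re_polygonVertex_zero_mul_conj_one]; norm_num
  have h1 : 0 < f (polygonVertex 6 1) := by
    simp only [hf, Complex.mul_conj, Complex.ofReal_re, Complex.normSq_pos]
    exact polygonVertex_ne_zero 1
  have h2 : 0 < f (polygonVertex 6 2) := by
    have : polygonVertex 6 2 = polygonVertex 6 1 * polygonVertex 6 1 := (polygonVertex_add 1 1)
    simp only [hf]
    rw [this, mul_assoc, Complex.mul_conj, Complex.normSq_eq_norm_sq, norm_polygonVertex]
    have h3 := re_polygonVertex_zero_mul_conj_one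
    rw [polygonVertex_zero, one_mul, Complex.conj_re] at h3
    simp [h3]
  have hlow : ∀ i : Fin 6, i < 3 → 0 < f (polygonVertex 6 i) := by
    intro i hi
    have : i = 0 ∨ i = 1 ∨ i = 2 := by omega
    rcases this with rfl | rfl | rfl <;> assumption
  have hhigh : ∀ i : Fin 6, 3 ≤ i → f (polygonVertex 6 i) < 0 := by
    intro i hi
    obtain ⟨j, hj, rfl⟩ : ∃ j : Fin 6, j < 3 ∧ i = 3 + j := by
      revert i; decide
    rw [hneg, hfneg]
    linarith [hlow j hj]
  rw [Set.not_disjoint_iff]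
  refine ⟨0, ⟨1 / 2, 1 / 2, by norm_num, by norm_num, by norm_num, ?_⟩,
    mem_outerFace_of_ray (d := Complex.I * polygonVertex 6 1) ?_ ?_⟩
  · have : polygonVertex 6 4 = - polygonVertex 6 1 := hneg 1
    rw [this]; simp
  · exact mul_ne_zero Complex.I_ne_zero (polygonVertex_ne_zero 1)
  · intro t ht hmem
    obtain ⟨u, v, huv, α, β, hα, hβ, hαβ, hx⟩ := mem_drawing_iff.mp hmem
    have hx' := congrArg f hx
    have hl : f (α • polygonVertex 6 u + β • polygonVertex 6 v) =
        α * f (polygonVertex 6 u) + β * f (polygonVertex 6 v) := by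
      simp only [hf, add_mul, Complex.add_re, Complex.real_smul, mul_assoc, Complex.re_ofReal_mul]
    have hr : f (0 + t • (Complex.I * polygonVertex 6 1)) = 0 := by
      simp only [hf, zero_add, Complex.real_smul, mul_assoc, Complex.re_ofReal_mul,
        Complex.mul_conj]
      simp
    rw [hl, hr] at hx'
    have hside : (u < 3 ∧ v < 3) ∨ (3 ≤ u ∧ 3 ≤ v) := by
      rcases lt_or_ge u 3 with hu | hu <;> rcases lt_or_ge v 3 with hv | hv
      · exact Or.inl ⟨hu, hv⟩
      · rcases huv with rfl | huv
        · exact Or.inl ⟨hu, hu⟩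
        · exact absurd huv (h u v hu hv)
      · rcases huv with rfl | huv
        · exact Or.inr ⟨hu, hu⟩
        · exact absurd huv.symm (h v u hv hu)
      · exact Or.inr ⟨hu, hv⟩
    rcases hside with ⟨hu, hv⟩ | ⟨hu, hv⟩
    · have hu' := hlow u hu
      have hv' := hlow v hv
      rcases hα.eq_or_lt with rfl | hα'
      · have : β = 1 := by linarith
        subst this
        linarith
      · linarith [mul_pos hα' hu', mul_nonneg hβ hv'.le]
    · have hu' := hhigh u hu
      have hv' := hhigh v hv
      rcases hα.eq_or_lt with rfl | hα'
      · have : β = 1 := by linarith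
        subst this
        linarith
      · linarith [mul_neg_of_pos_of_neg hα' hu', mul_nonpos_of_nonneg_of_nonpos hβ hv'.le]

/-! ### Finite search for placements, in terms of the non-adjacency relation -/

/-- The symmetric irreflexive relation on `Fin 4` with the given entries above the diagonal. -/
def relation4 (b01 b02 b03 b12 b13 b23 : Bool) : Fin 4 → Fin 4 → Bool :=
  ![![false, b01, b02, b03],
    ![b01, false, b12, b13],
    ![b02, b12, false, b23],
    ![b03, b13, b23, false]]

/-- The symmetric irreflexive relation on `Fin 5` with the given entries above the diagonal. -/
def relation5 (b01 b02 b03 b04 b12 b13 b14 b23 b24 b34 : Bool) : Fin 5 → Fin 5 → Bool :=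
  ![![false, b01, b02, b03, b04],
    ![b01, false, b12, b13, b14],
    ![b02, b12, false, b23, b24],
    ![b03, b13, b23, false, b34],
    ![b04, b14, b24, b34, false]]

/-- The symmetric irreflexive relation on `Fin 6` with the given entries above the diagonal. -/
def relation6 (b01 b02 b03 b04 b05 b12 b13 b14 b15 b23 b24 b25 b34 b35 b45 : Bool) :
    Fin 6 → Fin 6 → Bool :=
  ![![false, b01, b02, b03, b04, b05],
    ![b01, false, b12, b13, b14, b15],
    ![b02, b12, false, b23, b24, b25],
    ![b03, b13, b23, false, b34, b35],
    ![b04, b14, b24, b34, false, b45],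
    ![b05, b15, b25, b35, b45, false]]

/-- Replaces a quantifier over relations by one over finitely many Booleans, which the kernel can
enumerate. -/
theorem eq_relation4 (h : Fin 4 → Fin 4 → Bool) (hs : ∀ i j, h i j = h j i)
    (hi : ∀ i, h i i = false) :
    h = relation4 (h 0 1) (h 0 2) (h 0 3) (h 1 2) (h 1 3) (h 2 3) := by
  funext i j
  fin_cases i <;> fin_cases j <;> first | exact hi _ | exact hs _ _ | rfl

theorem eq_relation5 (h : Fin 5 → Fin 5 → Bool) (hs : ∀ i j, h i j = h j i)
    (hi : ∀ i, h i i = false) :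
    h = relation5
      (h 0 1) (h 0 2) (h 0 3) (h 0 4) (h 1 2) (h 1 3) (h 1 4) (h 2 3) (h 2 4) (h 3 4) := by
  funext i j
  fin_cases i <;> fin_cases j <;> first | exact hi _ | exact hs _ _ | rfl

theorem eq_relation6 (h : Fin 6 → Fin 6 → Bool) (hs : ∀ i j, h i j = h j i)
    (hi : ∀ i, h i i = false) :
    h = relation6
      (h 0 1) (h 0 2) (h 0 3) (h 0 4) (h 0 5) (h 1 2) (h 1 3) (h 1 4) (h 1 5) (h 2 3) (h 2 4) (h
      2 5) (h 3 4) (h 3 5) (h 4 5) := by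
  funext i j
  fin_cases i <;> fin_cases j <;> first | exact hi _ | exact hs _ _ | rfl

/-- A condition on the non-edges of a graph on the vertices of a square which ensures that every
non-edge meets the outer face. -/
def squareGood (a : Fin 4 → Fin 4 → Bool) : Bool :=
  (!a 0 2 || (a 0 1 || a 1 2)) && (!a 1 3 || (a 1 2 || a 2 3))

/-- A condition on the non-edges of a graph on the vertices of a regular pentagon which ensures
that every non-edge meets the outer face. -/
def pentagonGood (a : Fin 5 → Fin 5 → Bool) : Bool :=
  (!a 0 2 || (a 0 1 || a 1 2)) && (!a 1 3 || (a 1 2 || a 2 3)) &&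
  (!a 2 4 || (a 2 3 || a 3 4)) && (!a 3 0 || ((a 3 4 || a 4 0) || (a 0 1 && a 0 2))) &&
  (!a 4 1 || (a 4 0 || a 0 1))

/-- A condition on the non-edges of a graph on the vertices of a regular hexagon which ensures
that every non-edge meets the outer face. -/
def hexagonGood (a : Fin 6 → Fin 6 → Bool) : Bool :=
  (!a 0 2 || (a 0 1 || a 1 2)) && (!a 1 3 || (a 1 2 || a 2 3)) &&
  (!a 2 4 || (a 2 3 || a 3 4)) && (!a 3 5 || (a 3 4 || a 4 5)) &&
  (!a 4 0 || ((a 4 5 || a 5 0) || ((a 0 1 && a 0 2) && a 0 3))) && (!a 5 1 || (a 5 0 || a 0 1)) &&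
  (!a 0 3 || ((a 0 1 && a 0 2 || a 0 5 && a 0 4) || (a 3 4 && a 3 5 || a 3 2 && a 3 1))) &&
  (!a 2 5 || ((a 2 3 && a 2 4 || a 2 1 && a 2 0) || (a 5 0 && a 5 1 || a 5 4 && a 5 3))) &&
  (!a 1 4 || (((a 1 2 && a 1 3 || a 1 0 && a 1 5) || (a 4 5 && a 4 0 || a 4 3 && a 4 2)) ||
    ((a 0 3 && a 0 4 && a 0 5) && (a 1 3 && a 1 4 && a 1 5) && (a 2 3 && a 2 4 && a 2 5))))

/-- The relation `a` is the adjacency relation of the `5`-cycle `12345` with isolated vertex `0`. -/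
def isFiveCycle (a : Fin 6 → Fin 6 → Bool) : Bool :=
  !a 0 1 && !a 0 2 && !a 0 3 && !a 0 4 && !a 0 5 && a 1 2 && a 2 3 && a 3 4 && a 4 5 && a 5 1 &&
  !a 1 3 && !a 1 4 && !a 2 4 && !a 2 5 && !a 3 5

/-- Orders in which the search places the vertices on a square. -/
def squareOrders : List (Fin 4 → Fin 4) :=
  [![0, 1, 2, 3], ![1, 3, 0, 2]]

/-- Orders in which the search places the vertices on a regular pentagon. -/
def pentagonOrders : List (Fin 5 → Fin 5) :=
  [![0, 1, 2, 3, 4], ![0, 2, 4, 1, 3], ![1, 3, 0, 4, 2], ![3, 2, 4, 1, 0], ![2, 0, 3, 4, 1],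
   ![3, 1, 2, 0, 4], ![0, 1, 2, 4, 3]]

/-- Orders in which the search places the vertices on a regular hexagon. -/
def hexagonOrders : List (Fin 6 → Fin 6) :=
  [![5, 2, 4, 3, 1, 0], ![5, 1, 4, 0, 3, 2], ![0, 2, 1, 5, 3, 4], ![0, 5, 1, 4, 2, 3],
   ![0, 4, 2, 5, 3, 1], ![0, 5, 3, 4, 1, 2], ![0, 5, 4, 1, 2, 3], ![0, 4, 3, 2, 1, 5],
   ![0, 1, 4, 5, 3, 2], ![0, 1, 3, 5, 4, 2], ![0, 5, 2, 1, 3, 4], ![0, 3, 1, 4, 2, 5],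
   ![0, 1, 2, 3, 4, 5], ![0, 3, 4, 1, 2, 5], ![0, 3, 1, 5, 2, 4]]

/-- The cyclic orders of the vertices `1, 2, 3, 4, 5`, with the vertex `0` put in front. -/
def cycleOrders : List (Fin 6 → Fin 6) :=
  [![0, 1, 2, 3, 4, 5], ![0, 1, 2, 3, 5, 4], ![0, 1, 2, 4, 3, 5], ![0, 1, 2, 4, 5, 3],
   ![0, 1, 2, 5, 3, 4], ![0, 1, 2, 5, 4, 3], ![0, 1, 3, 2, 4, 5], ![0, 1, 3, 2, 5, 4],
   ![0, 1, 3, 4, 2, 5], ![0, 1, 3, 5, 2, 4], ![0, 1, 4, 2, 3, 5], ![0, 1, 4, 3, 2, 5]]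

theorem square_search (a : Fin 4 → Fin 4 → Bool) (hs : ∀ i j, a i j = a j i)
    (hi : ∀ i, a i i = false) :
    ∃ s : Fin 4 → Fin 4, Function.Injective s ∧ squareGood (fun i j => a (s i) (s j)) = true := by
  have key : ∀ b01 b02 b03 b12 b13 b23 : Bool, squareOrders.any (fun s =>
      squareGood fun i j => relation4 b01 b02 b03 b12 b13 b23 (s i) (s j)) = true := by
    decide +kernel
  have hinj : ∀ s ∈ squareOrders, Function.Injective s := by
    simpa [List.all_eq_true] using
      show squareOrders.all (fun s => decide (Function.Injective s)) = true by decide +kernel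
  rw [eq_relation4 a hs hi]
  obtain ⟨s, hsm, h⟩ := List.any_eq_true.mp (key _ _ _ _ _ _)
  exact ⟨s, hinj s hsm, h⟩

theorem pentagon_search (a : Fin 5 → Fin 5 → Bool) (hs : ∀ i j, a i j = a j i)
    (hi : ∀ i, a i i = false) :
    ∃ s : Fin 5 → Fin 5, Function.Injective s ∧
      pentagonGood (fun i j => a (s i) (s j)) = true := by
  have key : ∀ b01 b02 b03 b04 b12 b13 b14 b23 b24 b34 : Bool, pentagonOrders.any (fun s =>
      pentagonGood fun i j =>
        relation5 b01 b02 b03 b04 b12 b13 b14 b23 b24 b34 (s i) (s j)) = true := by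
    decide +kernel
  have hinj : ∀ s ∈ pentagonOrders, Function.Injective s := by
    simpa [List.all_eq_true] using
      show pentagonOrders.all (fun s => decide (Function.Injective s)) = true by decide +kernel
  rw [eq_relation5 a hs hi]
  obtain ⟨s, hsm, h⟩ := List.any_eq_true.mp (key _ _ _ _ _ _ _ _ _ _)
  exact ⟨s, hinj s hsm, h⟩

/-- Relabelling allows the number of non-neighbours to be assumed increasing, which leaves far fewer
of the `2 ^ 15` relations to test. The candidate orders are checked for sorted relations only. -/
theorem hexagon_search_of_le (a : Fin 6 → Fin 6 → Bool) (hs : ∀ i j, a i j = a j i)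
    (hi : ∀ i, a i i = false) (hm : Monotone fun i => ∑ j, (a i j).toNat) :
    (∃ s ∈ hexagonOrders, hexagonGood (fun i j => a (s i) (s j)) = true) ∨
      ∃ s ∈ cycleOrders, isFiveCycle (fun i j => a (s i) (s j)) = true := by
  -- Each row-sum inequality stands as soon as its Booleans are bound, so that the enumeration
  -- prunes early.
  have key : ∀ b01 b02 b03 b04 b05 b12 b13 b14 b15 : Bool,
      b01.toNat + b02.toNat + b03.toNat + b04.toNat + b05.toNat ≤
      b01.toNat + b12.toNat + b13.toNat + b14.toNat + b15.toNat →
      ∀ b23 b24 b25 : Bool,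
      b01.toNat + b12.toNat + b13.toNat + b14.toNat + b15.toNat ≤
      b02.toNat + b12.toNat + b23.toNat + b24.toNat + b25.toNat →
      ∀ b34 b35 : Bool,
      b02.toNat + b12.toNat + b23.toNat + b24.toNat + b25.toNat ≤
      b03.toNat + b13.toNat + b23.toNat + b34.toNat + b35.toNat →
      ∀ b45 : Bool,
      b03.toNat + b13.toNat + b23.toNat + b34.toNat + b35.toNat ≤
      b04.toNat + b14.toNat + b24.toNat + b34.toNat + b45.toNat →
      b04.toNat + b14.toNat + b24.toNat + b34.toNat + b45.toNat ≤
      b05.toNat + b15.toNat + b25.toNat + b35.toNat + b45.toNat →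
      (hexagonOrders.any (fun s => hexagonGood fun i j => relation6
        b01 b02 b03 b04 b05 b12 b13 b14 b15 b23 b24 b25 b34 b35 b45 (s i) (s j)) ||
      cycleOrders.any fun s => isFiveCycle fun i j => relation6
        b01 b02 b03 b04 b05 b12 b13 b14 b15 b23 b24 b25 b34 b35 b45 (s i) (s j)) = true := by
    decide +kernel
  have h01 := hm (show (0 : Fin 6) ≤ 1 by decide)
  have h12 := hm (show (1 : Fin 6) ≤ 2 by decide)
  have h23 := hm (show (2 : Fin 6) ≤ 3 by decide)
  have h34 := hm (show (3 : Fin 6) ≤ 4 by decide)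
  have h45 := hm (show (4 : Fin 6) ≤ 5 by decide)
  simp only [Fin.sum_univ_six, hi, Bool.toNat_false,
    hs 1 0, hs 2 0, hs 3 0, hs 4 0, hs 5 0, hs 2 1, hs 3 1, hs 4 1, hs 5 1, hs 3 2, hs 4 2, hs 5
    2, hs 4 3, hs 5 3, hs 5 4]
    at h01 h12 h23 h34 h45
  rw [eq_relation6 a hs hi]
  rw [← List.any_eq_true, ← List.any_eq_true, ← Bool.or_eq_true]
  exact key _ _ _ _ _ _ _ _ _ (by omega) _ _ _ (by omega) _ _ (by omega) _ (by omega) (by omega)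

theorem hexagon_search (a : Fin 6 → Fin 6 → Bool) (hs : ∀ i j, a i j = a j i)
    (hi : ∀ i, a i i = false) :
    (∃ s : Fin 6 → Fin 6, Function.Injective s ∧
      hexagonGood (fun i j => a (s i) (s j)) = true) ∨
    ∃ s : Fin 6 → Fin 6, Function.Injective s ∧
      isFiveCycle (fun i j => a (s i) (s j)) = true := by
  set τ := Tuple.sort fun i => ∑ j, (a i j).toNat with hτ
  have hm : Monotone fun i => ∑ j, (a (τ i) (τ j)).toNat := by
    have h := Tuple.monotone_sort fun i => ∑ j, (a i j).toNat
    rw [← hτ] at h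
    -- Permuting the columns leaves a row sum unchanged, so sorting the row sums sorts those of the
    -- relabelled relation.
    have e : (fun i => ∑ j, (a (τ i) (τ j)).toNat) = (fun i => ∑ j, (a i j).toNat) ∘ τ :=
      funext fun i => Equiv.sum_comp τ fun j => (a (τ i) j).toNat
    rwa [e]
  have h1 : ∀ s ∈ hexagonOrders, Function.Injective s := by
    simpa [List.all_eq_true] using
      show hexagonOrders.all (fun s => decide (Function.Injective s)) = true by decide +kernel
  have h2 : ∀ s ∈ cycleOrders, Function.Injective s := by
    simpa [List.all_eq_true] using
      show cycleOrders.all (fun s => decide (Function.Injective s)) = true by decide +kernel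
  rcases hexagon_search_of_le (fun i j => a (τ i) (τ j)) (fun _ _ => hs _ _) (fun _ => hi _) hm
    with ⟨s, hsm, h⟩ | ⟨s, hsm, h⟩
  · exact Or.inl ⟨τ ∘ s, τ.injective.comp (h1 s hsm), h⟩
  · exact Or.inr ⟨τ ∘ s, τ.injective.comp (h2 s hsm), h⟩

/-! ### From the Boolean conditions to representations -/

theorem isOOR_polygonVertex {n : ℕ} {G : SimpleGraph (Fin n)}
    (h : ∀ u v : Fin n, u < v → ¬ G.Adj u v →
      ¬ Disjoint (segment ℝ (polygonVertex n u) (polygonVertex n v))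
        (outerFace G (polygonVertex n))) :
    IsOOR G (polygonVertex n) := by
  refine ⟨polygonVertex_injective, fun u v huv => ⟨disjoint_outerFace_of_adj, fun hd => ?_⟩⟩
  by_contra hadj
  rcases lt_or_gt_of_ne huv with hlt | hlt
  · exact h u v hlt hadj hd
  · refine h v u hlt (fun h => hadj h.symm) ?_
    rwa [segment_symm]

/-- On one of the two sides of the segment from `i` to `j`, no segment at the vertex `i` is an edge,
and neither is the segment from `i` to `j` itself. -/
def HasFan {n : ℕ} [NeZero n] (G : SimpleGraph (Fin n)) (i j : Fin n) : Prop :=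
  (∀ k : Fin n, k ≠ 0 → k ≤ j - i → ¬ G.Adj i (i + k)) ∨
    ∀ k : Fin n, j - i ≤ k → ¬ G.Adj i (i + k)

theorem HasFan.not_disjoint {n : ℕ} [NeZero n] {G : SimpleGraph (Fin n)} {i j : Fin n}
    (hij : i < j) (h : HasFan G i j ∨ HasFan G j i) :
    ¬ Disjoint (segment ℝ (polygonVertex n i) (polygonVertex n j))
      (outerFace G (polygonVertex n)) := by
  rcases h with h | h
  · have := not_disjoint_segment_of_fan (sub_ne_zero.mpr hij.ne') h
    rwa [add_sub_cancel] at this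
  · have := not_disjoint_segment_of_fan (sub_ne_zero.mpr hij.ne) h
    rwa [add_sub_cancel, segment_symm] at this

/-- Any two vertices span a side of the polygon, which has no vertex beyond it, so a non-edge is a
fan by itself. No relabelling is needed. -/
theorem isOOR_of_le_three {n : ℕ} (hn : n ≤ 3) (G : SimpleGraph (Fin n)) :
    IsOOR G (polygonVertex n) := by
  refine isOOR_polygonVertex fun u v huv hadj => ?_
  have : NeZero n := ⟨by have := u.2; omega⟩
  have hadj' : ¬ G.Adj v u := fun h => hadj h.symm
  refine HasFan.not_disjoint huv ?_
  interval_cases n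
  · exact u.elim0
  · omega
  · fin_cases u <;> fin_cases v <;> simp_all [HasFan, Fin.forall_fin_succ]
  · fin_cases u <;> fin_cases v <;> simp_all [HasFan, Fin.forall_fin_succ]

/-- A diagonal of length two cuts off the single vertex `i + 1`. If `i` is not joined to it there is
a fan at `i`, otherwise one at `i + 2`. The hypotheses `hup` and `hdown` are index facts modulo `n`,
decided for each concrete `n`. -/
theorem HasFan.step_two {n : ℕ} [NeZero n] {G : SimpleGraph (Fin n)}
    (hup : ∀ i k : Fin n, k ≠ 0 → k ≤ i + 2 - i → k = 1 ∨ k = 2)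
    (hdown : ∀ i k : Fin n, i - (i + 2) ≤ k → i + 2 + k = i ∨ i + 2 + k = i + 1) (i : Fin n)
    (h2 : ¬ G.Adj i (i + 2)) (h1 : ¬ G.Adj i (i + 1) ∨ ¬ G.Adj (i + 1) (i + 2)) :
    HasFan G i (i + 2) ∨ HasFan G (i + 2) i := by
  rcases h1 with h1 | h1
  · refine Or.inl (Or.inl fun k hk hle => ?_)
    rcases hup i k hk hle with rfl | rfl <;> assumption
  · refine Or.inr (Or.inr fun k hle => ?_)
    rcases hdown i k hle with h | h <;> rw [h, G.adj_comm] <;> assumption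

theorem HasFan.step_one {n : ℕ} [NeZero n] {G : SimpleGraph (Fin n)}
    (hup : ∀ i k : Fin n, k ≠ 0 → k ≤ i + 1 - i → k = 1) (i : Fin n)
    (h1 : ¬ G.Adj i (i + 1)) : HasFan G i (i + 1) :=
  Or.inl fun k hk hle => by rwa [hup i k hk hle]

theorem HasFan.step_three {G : SimpleGraph (Fin 6)} (i : Fin 6) (h3 : ¬ G.Adj i (i + 3))
    (h : (¬ G.Adj i (i + 1) ∧ ¬ G.Adj i (i + 2)) ∨ (¬ G.Adj i (i + 5) ∧ ¬ G.Adj i (i + 4))) :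
    HasFan G i (i + 3) := by
  rcases h with ⟨h1, h2⟩ | ⟨h1, h2⟩
  · refine Or.inl fun k hk hle => ?_
    have : ∀ i k : Fin 6, k ≠ 0 → k ≤ i + 3 - i → k = 1 ∨ k = 2 ∨ k = 3 := by decide
    rcases this i k hk hle with rfl | rfl | rfl <;> assumption
  · refine Or.inr fun k hle => ?_
    have : ∀ i k : Fin 6, i + 3 - i ≤ k → k = 3 ∨ k = 4 ∨ k = 5 := by decide
    rcases this i k hle with rfl | rfl | rfl <;> assumption

theorem eq_true_of_clause {n : ℕ} {G : SimpleGraph (Fin n)} {a : Fin n → Fin n → Bool}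
    (ha : ∀ i j, a i j = true ↔ i ≠ j ∧ ¬ G.Adj i j) {i j : Fin n} (hij : i ≠ j)
    (hadj : ¬ G.Adj i j) {b : Bool} (h : (!a i j || b) = true) : b = true := by
  simpa [(ha i j).mpr ⟨hij, hadj⟩] using h

theorem isOOR_of_squareGood {G : SimpleGraph (Fin 4)} {a : Fin 4 → Fin 4 → Bool}
    (ha : ∀ i j, a i j = true ↔ i ≠ j ∧ ¬ G.Adj i j) (h : squareGood a = true) :
    IsOOR G (polygonVertex 4) := by
  refine isOOR_polygonVertex fun u v huv hadj => HasFan.not_disjoint huv ?_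
  have ha' : ∀ {i j}, a i j = true → ¬ G.Adj i j := fun h => ((ha _ _).mp h).2
  have s1 := fun i h => HasFan.step_one (G := G) (by decide) i h
  have s2 := fun i h h' => HasFan.step_two (G := G) (by decide) (by decide) i h h'
  have two : ∀ i, ¬ G.Adj i (i + 2) → (a i (i + 1) || a (i + 1) (i + 2)) = true →
      HasFan G i (i + 2) ∨ HasFan G (i + 2) i := fun i h h' =>
    s2 i h ((Bool.or_eq_true _ _ ▸ h').imp ha' ha')
  have hc := fun {b : Bool} => eq_true_of_clause (b := b) ha huv.ne hadj
  simp only [squareGood, Bool.and_eq_true] at h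
  fin_cases u <;> fin_cases v <;> first | exact absurd huv (by decide) | skip
  · exact Or.inl (s1 0 hadj)
  · exact two 0 hadj (hc h.1)
  · exact Or.inr (s1 3 fun h => hadj h.symm)
  · exact Or.inl (s1 1 hadj)
  · exact two 1 hadj (hc h.2)
  · exact Or.inl (s1 2 hadj)

theorem isOOR_of_pentagonGood {G : SimpleGraph (Fin 5)} {a : Fin 5 → Fin 5 → Bool}
    (ha : ∀ i j, a i j = true ↔ i ≠ j ∧ ¬ G.Adj i j) (h : pentagonGood a = true) :
    IsOOR G (polygonVertex 5) := by
  refine isOOR_polygonVertex fun u v huv hadj => HasFan.not_disjoint huv ?_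
  have ha' : ∀ {i j}, a i j = true → ¬ G.Adj i j := fun h => ((ha _ _).mp h).2
  have hadj' : ¬ G.Adj v u := fun h => hadj h.symm
  have s1 := fun i h => HasFan.step_one (G := G) (by decide) i h
  have s2 := fun i h h' => HasFan.step_two (G := G) (by decide) (by decide) i h h'
  have two : ∀ i, ¬ G.Adj i (i + 2) → (a i (i + 1) || a (i + 1) (i + 2)) = true →
      HasFan G i (i + 2) ∨ HasFan G (i + 2) i := fun i h h' =>
    s2 i h ((Bool.or_eq_true _ _ ▸ h').imp ha' ha')
  have hc := fun {b : Bool} => eq_true_of_clause (b := b) ha huv.ne hadj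
  have hc' := fun {b : Bool} => eq_true_of_clause (b := b) ha huv.ne' hadj'
  simp only [pentagonGood, Bool.and_eq_true] at h
  obtain ⟨⟨⟨⟨h02, h13⟩, h24⟩, h30⟩, h41⟩ := h
  fin_cases u <;> fin_cases v <;> first | exact absurd huv (by decide) | skip
  · exact Or.inl (s1 0 hadj)
  · exact two 0 hadj (hc h02)
  · rcases (Bool.or_eq_true _ _).mp (hc' h30) with h | h
    · exact (two 3 hadj' h).symm
    -- The remaining alternative is a fan at `0` on the other side of the diagonal, over `1`, `2`,
    -- `3`.
    · refine Or.inl (Or.inl fun k hk hle => ?_)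
      have h1 := ha' ((Bool.and_eq_true _ _).mp h).1
      have h2 := ha' ((Bool.and_eq_true _ _).mp h).2
      have : ∀ k : Fin 5, k ≠ 0 → k ≤ 3 - 0 → k = 1 ∨ k = 2 ∨ k = 3 := by decide
      rcases this k hk hle with rfl | rfl | rfl <;> assumption
  · exact Or.inr (s1 4 hadj')
  · exact Or.inl (s1 1 hadj)
  · exact two 1 hadj (hc h13)
  · exact (two 4 hadj' (hc' h41)).symm
  · exact Or.inl (s1 2 hadj)
  · exact two 2 hadj (hc h24)
  · exact Or.inl (s1 3 hadj)

theorem isOOR_of_hexagonGood {G : SimpleGraph (Fin 6)} {a : Fin 6 → Fin 6 → Bool}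
    (ha : ∀ i j, a i j = true ↔ i ≠ j ∧ ¬ G.Adj i j) (h : hexagonGood a = true) :
    IsOOR G (polygonVertex 6) := by
  refine isOOR_polygonVertex fun u v huv hadj => ?_
  have ha' : ∀ {i j}, a i j = true → ¬ G.Adj i j := fun h => ((ha _ _).mp h).2
  have hadj' : ¬ G.Adj v u := fun h => hadj h.symm
  have s1 := fun i h => HasFan.step_one (G := G) (by decide) i h
  have s2 := fun i h h' => HasFan.step_two (G := G) (by decide) (by decide) i h h'
  have two : ∀ i, ¬ G.Adj i (i + 2) → (a i (i + 1) || a (i + 1) (i + 2)) = true →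
      HasFan G i (i + 2) ∨ HasFan G (i + 2) i := fun i h h' =>
    s2 i h ((Bool.or_eq_true _ _ ▸ h').imp ha' ha')
  have and' : ∀ {i j k l : Fin 6}, (a i j && a k l) = true → ¬ G.Adj i j ∧ ¬ G.Adj k l :=
    fun h => ((Bool.and_eq_true _ _).mp h).imp ha' ha'
  have three : ∀ i, ¬ G.Adj i (i + 3) →
      (a i (i + 1) && a i (i + 2) || a i (i + 5) && a i (i + 4)) = true → HasFan G i (i + 3) :=
    fun i h h' => HasFan.step_three i h (((Bool.or_eq_true _ _).mp h').imp and' and')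
  have hc := fun {b : Bool} => eq_true_of_clause (b := b) ha huv.ne hadj
  have hc' := fun {b : Bool} => eq_true_of_clause (b := b) ha huv.ne' hadj'
  simp only [hexagonGood, Bool.and_eq_true (_ && _), Bool.and_eq_true (_ || _)] at h
  obtain ⟨⟨⟨⟨⟨⟨⟨⟨h02, h13⟩, h24⟩, h35⟩, h40⟩, h51⟩, h03⟩, h25⟩, h14⟩ := h
  -- The diagonal `14` is treated apart, as only its clause admits the split into two halves.
  by_cases h14' : u = 1 ∧ v = 4
  · obtain ⟨rfl, rfl⟩ := h14'
    rcases (Bool.or_eq_true _ _).mp (hc h14) with h | h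
    · refine HasFan.not_disjoint huv ?_
      exact ((Bool.or_eq_true _ _).mp h).imp (three 1 hadj) (three 4 hadj')
    · refine not_disjoint_segment_of_split fun i j hi hj => ?_
      simp only [Bool.and_eq_true] at h
      obtain ⟨⟨⟨⟨h03, h04⟩, h05⟩, ⟨h13, h14⟩, h15⟩, ⟨h23, h24⟩, h25⟩ := h
      have hi' : i = 0 ∨ i = 1 ∨ i = 2 := by omega
      have hj' : j = 3 ∨ j = 4 ∨ j = 5 := by omega
      rcases hi' with rfl | rfl | rfl <;> rcases hj' with rfl | rfl | rfl <;>
        exact ha' (by assumption)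
  refine HasFan.not_disjoint huv ?_
  fin_cases u <;> fin_cases v <;> first | exact absurd huv (by decide) | skip
  · exact Or.inl (s1 0 hadj)
  · exact two 0 hadj (hc h02)
  · exact ((Bool.or_eq_true _ _).mp (hc h03)).imp (three 0 hadj) (three 3 hadj')
  · rcases (Bool.or_eq_true _ _).mp (hc' h40) with h | h
    · exact (two 4 hadj' h).symm
    -- Here the fan at `0` uses the larger side, over `1`, `2`, `3`, `4`.
    · refine Or.inl (Or.inl fun k hk hle => ?_)
      obtain ⟨h12, h3⟩ := (Bool.and_eq_true _ _).mp h
      obtain ⟨h1, h2⟩ := and' h12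
      replace h3 := ha' h3
      have : ∀ k : Fin 6, k ≠ 0 → k ≤ 4 - 0 → k = 1 ∨ k = 2 ∨ k = 3 ∨ k = 4 := by decide
      rcases this k hk hle with rfl | rfl | rfl | rfl <;> assumption
  · exact Or.inr (s1 5 hadj')
  · exact Or.inl (s1 1 hadj)
  · exact two 1 hadj (hc h13)
  · exact absurd ⟨rfl, rfl⟩ h14'
  · exact (two 5 hadj' (hc' h51)).symm
  · exact Or.inl (s1 2 hadj)
  · exact two 2 hadj (hc h24)
  · exact ((Bool.or_eq_true _ _).mp (hc h25)).imp (three 2 hadj) (three 5 hadj')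
  · exact Or.inl (s1 3 hadj)
  · exact two 3 hadj (hc h35)
  · exact Or.inl (s1 4 hadj)

/-! ### The exceptional graph and the existence half -/

instance wheelGraphDecidableRel (n : ℕ) : DecidableRel (wheelGraph n).Adj
  | none, none => inferInstanceAs (Decidable False)
  | none, some _ => inferInstanceAs (Decidable True)
  | some _, none => inferInstanceAs (Decidable True)
  | some i, some j => inferInstanceAs (Decidable ((SimpleGraph.cycleGraph (n - 1)).Adj i j))

/-- The rim vertices of the wheel, numbered so that the non-edges form the cycle `12345`. -/
def wheelEquivFin : Fin 6 ≃ Option (Fin 5) where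
  toFun := ![none, some 0, some 3, some 1, some 4, some 2]
  invFun x := x.elim 0 ![1, 3, 5, 2, 4]
  left_inv := by decide
  right_inv := by decide

/-- As `a` records non-edges, its isolated vertex is the hub, and the complement of its 5-cycle is
again a 5-cycle, the rim. -/
theorem nonempty_iso_wheelGraph_of_isFiveCycle {G : SimpleGraph (Fin 6)}
    {a : Fin 6 → Fin 6 → Bool} (ha : ∀ i j, a i j = true ↔ i ≠ j ∧ ¬ G.Adj i j)
    (h : isFiveCycle a = true) : Nonempty (G ≃g wheelGraph 6) := by
  have hs : ∀ i j, a i j = a j i := fun i j => by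
    rw [Bool.eq_iff_iff, ha, ha, G.adj_comm, ne_comm]
  have hi : ∀ i, a i i = false := fun i => by
    rw [← Bool.not_eq_true, ha]
    exact fun h => h.1 rfl
  have hG : ∀ i j, G.Adj i j ↔ i ≠ j ∧ a i j = false := fun i j => by
    rw [← Bool.not_eq_true, ha]
    have := G.ne_of_adj (a := i) (b := j)
    tauto
  have he := eq_relation6 a hs hi
  simp only [isFiveCycle, Bool.and_eq_true, Bool.not_eq_true'] at h
  rw [hs 5 1] at h
  simp only [h] at he
  refine ⟨⟨wheelEquivFin, fun {i j} => ?_⟩⟩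
  rw [hG, he]
  revert i j
  decide

theorem exists_perm_isOOR {n : ℕ} (hn : n ≤ 6) (G : SimpleGraph (Fin n)) :
    (∃ s : Fin n ≃ Fin n, IsOOR (G.comap s) (polygonVertex n)) ∨
      Nonempty (G ≃g wheelGraph 6) := by
  classical
  rcases Nat.lt_or_ge 3 n with h3 | h3
  · obtain ⟨a, ha⟩ : ∃ a : Fin n → Fin n → Bool, ∀ i j, a i j = true ↔ i ≠ j ∧ ¬ G.Adj i j :=
      ⟨fun i j => decide (i ≠ j ∧ ¬ G.Adj i j), fun i j => decide_eq_true_iff⟩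
    have hs : ∀ i j, a i j = a j i := fun i j => by
      rw [Bool.eq_iff_iff, ha, ha, G.adj_comm, ne_comm]
    have hi : ∀ i, a i i = false := fun i => by
      rw [← Bool.not_eq_true, ha]
      exact fun h => h.1 rfl
    have hcomap : ∀ (s : Fin n ≃ Fin n) (i j : Fin n),
        a (s i) (s j) = true ↔ i ≠ j ∧ ¬ (G.comap s).Adj i j := fun s i j => by
      rw [ha, SimpleGraph.comap_adj, s.injective.ne_iff]
    interval_cases n
    · obtain ⟨s, hinj, h⟩ := square_search a hs hi
      exact Or.inl ⟨Equiv.ofBijective s (Finite.injective_iff_bijective.mp hinj),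
        isOOR_of_squareGood (hcomap (Equiv.ofBijective s _)) h⟩
    · obtain ⟨s, hinj, h⟩ := pentagon_search a hs hi
      exact Or.inl ⟨Equiv.ofBijective s (Finite.injective_iff_bijective.mp hinj),
        isOOR_of_pentagonGood (hcomap (Equiv.ofBijective s _)) h⟩
    · rcases hexagon_search a hs hi with ⟨s, hinj, h⟩ | ⟨s, hinj, h⟩
      · exact Or.inl ⟨Equiv.ofBijective s (Finite.injective_iff_bijective.mp hinj),
          isOOR_of_hexagonGood (hcomap (Equiv.ofBijective s _)) h⟩
      · obtain ⟨e⟩ := nonempty_iso_wheelGraph_of_isFiveCycle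
          (hcomap (Equiv.ofBijective s (Finite.injective_iff_bijective.mp hinj))) h
        exact Or.inr ⟨(SimpleGraph.Iso.comap _ G).symm.trans e⟩
  · exact Or.inl ⟨Equiv.refl _, isOOR_of_le_three h3 _⟩

theorem hasRegularOOR_of_not_iso_wheelGraph {V : Type*} [Fintype V] (G : SimpleGraph V)
    (hV : Fintype.card V ≤ 6) (h : ¬ Nonempty (G ≃g wheelGraph 6)) : HasRegularOOR G := by
  let f := (Fintype.equivFin V).symm
  rcases exists_perm_isOOR hV (G.comap f) with ⟨s, hs⟩ | ⟨⟨e⟩⟩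
  · refine ⟨polygonVertex _ ∘ (s.trans f).symm,
      hs.comp_iso ((SimpleGraph.Iso.comap f G).symm.trans (SimpleGraph.Iso.comap s _).symm),
      0, 1, one_ne_zero, (s.trans f).symm, fun v => ?_⟩
    simp [polygonVertex]
  · exact absurd ⟨(SimpleGraph.Iso.comap f G).symm.trans e⟩ h

theorem nonempty_iso_completeMinusCycle :
    Nonempty (wheelGraph 6 ≃g completeMinusCycle 6 5 (by norm_num)) := by
  -- The hub goes to `5` and the rim vertex `i` to `2 * i` modulo `5`. This takes rim edges to pairs
  -- at distance two, which are the pairs kept when the 5-cycle is deleted.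
  refine ⟨⟨⟨fun x => x.elim 5 ![0, 2, 4, 1, 3], ![some 0, some 3, some 1, some 4, some 2, none],
    by decide, by decide⟩, fun {x y} => ?_⟩⟩
  simp only [completeMinusCycle, SimpleGraph.sdiff_adj, SimpleGraph.top_adj, SimpleGraph.map_adj]
  revert x y
  decide

/-! ### Regular placements are convex -/

/-- All points lie on one circle, and the open half-plane bounded by the tangent at `p v` contains
every other point but not `p v`. -/
theorem IsRegularPolygonPlacement.convexIndependent {V : Type*} [Fintype V] {p : V → ℂ}
    (hp : IsRegularPolygonPlacement p) (hinj : Function.Injective p) :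
    ConvexIndependent ℝ p := by
  obtain ⟨c, z, hz, σ, h⟩ := hp
  have hn : ∀ v, ‖p v - c‖ = ‖z‖ := fun v => by
    rw [h v, add_sub_cancel_left, norm_mul]
    have := norm_polygonVertex (σ v)
    rw [polygonVertex] at this
    rw [this, mul_one]
  rw [convexIndependent_iff_notMem_convexHull_sdiff]
  intro v s hv
  set w := p v - c with hw
  have hconv : Convex ℝ {x : ℂ | inner ℝ w (x - c) < ‖z‖ ^ 2} := by
    have : {x : ℂ | inner ℝ w (x - c) < ‖z‖ ^ 2} =
        {x : ℂ | innerSL ℝ w x < ‖z‖ ^ 2 + inner ℝ w c} := by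
      ext x
      simp only [Set.mem_ofPred_eq, inner_sub_right, innerSL_apply_apply]
      exact sub_lt_iff_lt_add
    rw [this]
    exact convex_halfSpace_lt (innerSL ℝ w).isLinear _
  have hsub := convexHull_min (s := p '' (s \ {v})) (t := {x : ℂ | inner ℝ w (x - c) < ‖z‖ ^ 2})
    (by
      rintro _ ⟨u, hu, rfl⟩
      have hne : w - (p u - c) ≠ 0 := by
        rw [hw, sub_sub_sub_cancel_right, sub_ne_zero]
        exact fun e => hu.2 (hinj e).symm
      have h1 := norm_sub_sq_real w (p u - c)
      rw [hn u, hn v] at h1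
      have h2 := pow_pos (norm_pos_iff.mpr hne) 2
      simp only [Set.mem_ofPred_eq]
      linarith) hconv hv
  simp only [Set.mem_ofPred_eq, ← hw, real_inner_self_eq_norm_sq] at hsub
  rw [hn v] at hsub
  exact lt_irrefl _ hsub

theorem HasRegularOOR.hasConvexOOR {V : Type*} [Fintype V] {G : SimpleGraph V}
    (h : HasRegularOOR G) : HasConvexOOR G := by
  obtain ⟨p, hp, hr⟩ := h
  exact ⟨p, hp, hr.convexIndependent hp.1⟩

/-! ### The wheel has no convex representation -/

/-- Here `τ` lists the rim by angular position. If the first and last positions are not adjacent,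
connectedness of the rim already gives the claim for them; the exhaustive check also covers the
other orders. -/
theorem wheel_chord_search (τ : Equiv.Perm (Fin 5)) :
    ∃ u v : Fin 5, u < v ∧ ¬ (SimpleGraph.cycleGraph 5).Adj (τ u) (τ v) ∧
      ∀ i, u ≤ i → i < v → ∃ u' v', u ≤ u' ∧ u' ≤ i ∧ i < v' ∧ v' ≤ v ∧
        (SimpleGraph.cycleGraph 5).Adj (τ u') (τ v') := by
  revert τ
  decide +kernel

/-- The oriented area of the parallelogram spanned by two vectors of the plane. -/
def cross (z w : ℂ) : ℝ := z.re * w.im - z.im * w.re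

/-- The sides of the triangle belong to the drawing, so the component of a point of the complement
in the closed triangle cannot leave the open triangle, which is bounded. -/
theorem notMem_outerFace_of_mem_triangle {V : Type*} {G : SimpleGraph V} {p : V → ℂ} {o a b : V}
    (hoa : G.Adj o a) (hob : G.Adj o b) (hab : G.Adj a b)
    (hpos : 0 < cross (p a - p o) (p b - p o)) {x : ℂ} (h1 : 0 ≤ cross (p a - p o) (x - p o))
    (h2 : 0 ≤ cross (x - p o) (p b - p o)) (h3 : 0 ≤ cross (p b - p a) (x - p a)) :
    x ∉ outerFace G p := by
  rintro ⟨hx, hunb⟩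
  set A := p a with hA
  set B := p b with hB
  set O := p o with hO
  set Δ := cross (A - O) (B - O) with hΔ
  have hsum : ∀ y, cross (A - O) (y - O) + cross (y - O) (B - O) + cross (B - A) (y - A) = Δ := by
    intro y
    simp only [hΔ, cross, Complex.sub_re, Complex.sub_im]
    ring
  -- The three cross products, divided by `Δ`, are the barycentric coordinates of `y`.
  have hrep : ∀ y, y = (cross (B - A) (y - A) / Δ) • O + (cross (y - O) (B - O) / Δ) • A +
      (cross (A - O) (y - O) / Δ) • B := by
    intro y
    have hΔ' := hpos.ne'
    apply Complex.ext <;>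
    · simp only [Complex.add_re, Complex.add_im, Complex.smul_re, Complex.smul_im, smul_eq_mul]
      field_simp
      simp only [hΔ, cross, Complex.sub_re, Complex.sub_im]
      ring
  -- A vanishing coordinate would put `y` on a side of the triangle, hence on the drawing.
  have hside : ∀ y, y ∈ (drawing G p)ᶜ → 0 ≤ cross (A - O) (y - O) →
      0 ≤ cross (y - O) (B - O) → 0 ≤ cross (B - A) (y - A) →
      0 < cross (A - O) (y - O) ∧ 0 < cross (y - O) (B - O) ∧ 0 < cross (B - A) (y - A) := by
    intro y hy g1 g2 g3
    have hs := hsum y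
    have hr := hrep y
    have hone : cross (A - O) (y - O) / Δ + cross (y - O) (B - O) / Δ +
        cross (B - A) (y - A) / Δ = 1 := by
      rw [← add_div, ← add_div, hs, div_self hpos.ne']
    refine ⟨g1.lt_of_ne' fun h => hy ?_, g2.lt_of_ne' fun h => hy ?_, g3.lt_of_ne' fun h => hy ?_⟩
    · refine mem_drawing_iff.mpr ⟨o, a, Or.inr hoa, _, _, div_nonneg g3 hpos.le,
        div_nonneg g2 hpos.le, ?_, ?_⟩
      · rw [h, zero_div] at hone; linarith
      · rw [h, zero_div, zero_smul, add_zero] at hr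
        exact hr.symm
    · refine mem_drawing_iff.mpr ⟨o, b, Or.inr hob, _, _, div_nonneg g3 hpos.le,
        div_nonneg g1 hpos.le, ?_, ?_⟩
      · rw [h, zero_div] at hone; linarith
      · rw [h, zero_div, zero_smul, add_zero] at hr
        exact hr.symm
    · refine mem_drawing_iff.mpr ⟨a, b, Or.inr hab, _, _, div_nonneg g2 hpos.le,
        div_nonneg g1 hpos.le, ?_, ?_⟩
      · rw [h, zero_div] at hone; linarith
      · rw [h, zero_div, zero_smul, zero_add] at hr
        exact hr.symm
  have c1 : Continuous fun y : ℂ => cross (A - O) (y - O) := by unfold cross; fun_prop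
  have c2 : Continuous fun y : ℂ => cross (y - O) (B - O) := by unfold cross; fun_prop
  have c3 : Continuous fun y : ℂ => cross (B - A) (y - A) := by unfold cross; fun_prop
  have hsub : connectedComponentIn (drawing G p)ᶜ x ⊆ {y | 0 < cross (A - O) (y - O) ∧
      0 < cross (y - O) (B - O) ∧ 0 < cross (B - A) (y - A)} := by
    -- Off the drawing, the open triangle and the exterior of the closed one are two disjoint open
    -- sets that cover everything.
    refine isPreconnected_connectedComponentIn.subset_left_of_subset_union
      (v := {y | cross (A - O) (y - O) < 0 ∨ cross (y - O) (B - O) < 0 ∨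
        cross (B - A) (y - A) < 0}) ?_ ?_ ?_ ?_ ?_
    · exact (isOpen_lt continuous_const c1).inter
        ((isOpen_lt continuous_const c2).inter (isOpen_lt continuous_const c3))
    · exact (isOpen_lt c1 continuous_const).union
        ((isOpen_lt c2 continuous_const).union (isOpen_lt c3 continuous_const))
    · rw [Set.disjoint_left]
      rintro y ⟨g1, g2, g3⟩ (g | g | g)
      · exact lt_asymm g1 g
      · exact lt_asymm g2 g
      · exact lt_asymm g3 g
    · intro y hy
      have hy' := connectedComponentIn_subset _ _ hy
      by_cases g1 : cross (A - O) (y - O) < 0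
      · exact Or.inr (Or.inl g1)
      by_cases g2 : cross (y - O) (B - O) < 0
      · exact Or.inr (Or.inr (Or.inl g2))
      by_cases g3 : cross (B - A) (y - A) < 0
      · exact Or.inr (Or.inr (Or.inr g3))
      exact Or.inl (hside y hy' (not_lt.mp g1) (not_lt.mp g2) (not_lt.mp g3))
    · exact ⟨x, mem_connectedComponentIn hx, hside x hx h1 h2 h3⟩
  refine hunb ((isBounded_iff_forall_norm_le.mpr ⟨‖O‖ + ‖A‖ + ‖B‖, ?_⟩).subset hsub)
  rintro y ⟨g1, g2, g3⟩
  have hs := hsum y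
  have hle : ∀ (t : ℝ) (z : ℂ), 0 < t → t ≤ Δ → ‖(t / Δ) • z‖ ≤ ‖z‖ := by
    intro t z ht htΔ
    rw [norm_smul, Real.norm_of_nonneg (by positivity)]
    exact mul_le_of_le_one_left (norm_nonneg _) ((div_le_one hpos).mpr htΔ)
  rw [hrep y]
  exact norm_add₃_le.trans (add_le_add_three (hle _ _ g3 (by linarith)) (hle _ _ g2 (by linarith))
    (hle _ _ g1 (by linarith)))

/-- The indices `a`, `b`, `c` may coincide, so this also excludes points on a segment. -/
theorem ConvexIndependent.ne_of_three {ι : Type*} {p : ι → ℂ} (hp : ConvexIndependent ℝ p)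
    {v a b c : ι} (ha : v ≠ a) (hb : v ≠ b) (hc : v ≠ c) {α β γ : ℝ} (hα : 0 ≤ α) (hβ : 0 ≤ β)
    (hγ : 0 ≤ γ) (hsum : α + β + γ = 1) : p v ≠ α • p a + β • p b + γ • p c := by
  intro h
  refine convexIndependent_iff_notMem_convexHull_sdiff.mp hp v {a, b, c} ?_
  have hmem : ∀ u ∈ ({a, b, c} : Set ι), u ≠ v →
      p u ∈ convexHull ℝ (p '' ({a, b, c} \ {v})) := fun u hu hne =>
    subset_convexHull ℝ _ ⟨u, ⟨hu, hne⟩, rfl⟩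
  have := (convex_convexHull ℝ (p '' ({a, b, c} \ {v}))).sum_mem (t := Finset.univ)
    (w := ![α, β, γ]) (z := ![p a, p b, p c]) (by simp [Fin.forall_fin_succ, *])
    (by simp [Fin.sum_univ_three, hsum]) (by
      simp only [Fin.forall_fin_succ, Finset.mem_univ, forall_const]
      exact ⟨hmem a (by simp) ha.symm, hmem b (by simp) hb.symm, hmem c (by simp) hc.symm,
        fun i => i.elim0⟩)
  rw [h]
  simpa [Fin.sum_univ_three] using this

theorem map_eq_re_im (f : ℂ →L[ℝ] ℝ) (z : ℂ) : f z = z.re * f 1 + z.im * f Complex.I := by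
  conv_lhs => rw [← Complex.re_add_im z]
  rw [map_add, ← smul_eq_mul (z.im : ℂ), Complex.coe_smul, map_smul, smul_eq_mul]
  congr 1
  rw [show (z.re : ℂ) = z.re • (1 : ℂ) by simp, map_smul, smul_eq_mul]

/-- The points of a set in convex position can be sorted by the angle around one of them. -/
theorem exists_angular_order {n : ℕ} {q : Option (Fin n) → ℂ} (hq : ConvexIndependent ℝ q) :
    ∃ (f : ℂ →L[ℝ] ℝ) (τ : Equiv.Perm (Fin n)), (∀ i, 0 < f (q (some i) - q none)) ∧
      ∀ i j, i < j → 0 < cross (q (some (τ i)) - q none) (q (some (τ j)) - q none) := by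
  have hnot : q none ∉ convexHull ℝ (Set.range fun i => q (some i)) := by
    have h := convexIndependent_iff_notMem_convexHull_sdiff.mp hq none Set.univ
    refine fun hmem => h (convexHull_mono ?_ hmem)
    rintro _ ⟨i, rfl⟩
    exact ⟨some i, by simp, rfl⟩
  -- The hub is a vertex of the convex hull, so a linear functional separates it strictly from the
  -- rim. All rim directions then lie in an open half-plane, where angles are linearly ordered.
  obtain ⟨f, u, hu, hf⟩ := geometric_hahn_banach_point_closed (convex_convexHull ℝ _)
    ((Set.finite_range fun i => q (some i)).isClosed_convexHull ℝ) hnot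
  have hpos : ∀ i, 0 < f (q (some i) - q none) := fun i => by
    have := hf _ (subset_convexHull ℝ _ ⟨i, rfl⟩)
    rw [map_sub]
    linarith
  have hfe := map_eq_re_im f
  -- Up to a common factor, `f` and `g` are orthogonal coordinates; `g / f` is the tangent of the
  -- angle and serves as the sorting key.
  set g : ℂ → ℝ := fun z => f (-Complex.I * z) with hg
  have hge : ∀ z : ℂ, g z = z.im * f 1 - z.re * f Complex.I := by
    intro z
    rw [hg]
    simp only
    rw [hfe]
    simp
    ring
  have hcross : ∀ z w, f z * g w - f w * g z = (f 1 ^ 2 + f Complex.I ^ 2) * cross z w := by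
    intro z w
    rw [hfe z, hfe w, hge, hge, cross]
    ring
  set key : Fin n → ℝ := fun i => g (q (some i) - q none) / f (q (some i) - q none) with hkey
  -- Equal keys would put two rim points on one ray from the hub, with the nearer one on the segment
  -- from the hub to the farther one.
  have hinj : Function.Injective key := by
    intro i j hij
    by_contra hne
    wlog hle : f (q (some i) - q none) ≤ f (q (some j) - q none) generalizing i j
    · exact this hij.symm (fun h => hne h.symm) (le_of_not_ge hle)
    have hi := hpos i
    have hj := hpos j
    simp only [hkey] at hij
    rw [div_eq_div_iff hi.ne' hj.ne'] at hij
    set t := f (q (some i) - q none) / f (q (some j) - q none) with ht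
    have ht0 : 0 ≤ t := by positivity
    have ht1 : t ≤ 1 := (div_le_one hj).mpr hle
    have htj : t * f (q (some j) - q none) = f (q (some i) - q none) := div_mul_cancel₀ _ hj.ne'
    have hz : ∀ z : ℂ, f z = 0 → g z = 0 → 0 < f 1 ^ 2 + f Complex.I ^ 2 → z = 0 := by
      intro z h1 h2 h3
      rw [hfe] at h1
      rw [hge] at h2
      apply Complex.ext
      · have : (f 1 ^ 2 + f Complex.I ^ 2) * z.re = 0 := by
          linear_combination f 1 * h1 - f Complex.I * h2
        simpa [h3.ne'] using this
      · have : (f 1 ^ 2 + f Complex.I ^ 2) * z.im = 0 := by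
          linear_combination f Complex.I * h1 + f 1 * h2
        simpa [h3.ne'] using this
    have hnz : 0 < f 1 ^ 2 + f Complex.I ^ 2 := by
      by_contra hcon
      have h1 : f 1 = 0 := by nlinarith [sq_nonneg (f 1), sq_nonneg (f Complex.I)]
      have h2 : f Complex.I = 0 := by nlinarith [sq_nonneg (f 1), sq_nonneg (f Complex.I)]
      rw [hfe, h1, h2] at hi
      simp at hi
    have hgl : ∀ z w : ℂ, g (z - t • w) = g z - t * g w := by
      intro z w
      simp only [hg, mul_sub, mul_smul_comm, map_sub, map_smul, smul_eq_mul]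
    have heq := hz ((q (some i) - q none) - t • (q (some j) - q none))
      (by rw [map_sub, map_smul, smul_eq_mul, htj, sub_self])
      (by
        rw [hgl, ht, div_mul_eq_mul_div, sub_eq_zero, eq_div_iff hj.ne', hij]
        ring) hnz
    refine hq.ne_of_three (v := some i) (a := none) (b := none) (c := some j) (by simp) (by simp)
      (by simpa using hne) (sub_nonneg.mpr ht1) le_rfl ht0 (by ring) ?_
    rw [sub_eq_zero, sub_eq_iff_eq_add] at heq
    rw [heq]
    module
  refine ⟨f, Tuple.sort key, hpos, fun i j hij => ?_⟩
  have hlt : key (Tuple.sort key i) < key (Tuple.sort key j) :=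
    ((Tuple.monotone_sort key).strictMono_of_injective
      (hinj.comp (Tuple.sort key).injective)) hij
  simp only [hkey] at hlt
  rw [div_lt_div_iff₀ (hpos _) (hpos _)] at hlt
  have h := hcross (q (some (Tuple.sort key i)) - q none) (q (some (Tuple.sort key j)) - q none)
  have h' : 0 < (f 1 ^ 2 + f Complex.I ^ 2) *
      cross (q (some (Tuple.sort key i)) - q none) (q (some (Tuple.sort key j)) - q none) := by
    rw [← h]; linarith
  by_contra hn
  exact h'.not_ge (mul_nonpos_of_nonneg_of_nonpos (by positivity) (not_lt.mp hn))

/-- Otherwise the middle point `B`, seen from the hub between `A` and `C`, would lie in the triangle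
`OAC`, against convex position. -/
theorem cross_triangle_pos {n : ℕ} {q : Option (Fin n) → ℂ} (hq : ConvexIndependent ℝ q)
    {i j k : Fin n} (hij : 0 < cross (q (some i) - q none) (q (some j) - q none))
    (hjk : 0 < cross (q (some j) - q none) (q (some k) - q none))
    (hik : 0 < cross (q (some i) - q none) (q (some k) - q none)) :
    0 < cross (q (some j) - q (some i)) (q (some k) - q (some i)) := by
  set O := q none with hO
  set A := q (some i) with hA
  set B := q (some j) with hB
  set C := q (some k) with hC
  by_contra hneg
  have e : cross (B - A) (C - A) =
      cross (A - O) (B - O) + cross (B - O) (C - O) - cross (A - O) (C - O) := by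
    simp only [cross, Complex.sub_re, Complex.sub_im]
    ring
  have hself : ∀ z, cross z z = 0 := fun z => by rw [cross]; ring
  have hji : j ≠ i := by
    rintro rfl
    rw [hself] at hij
    exact lt_irrefl _ hij
  have hjk' : j ≠ k := by
    rintro rfl
    rw [hself] at hjk
    exact lt_irrefl _ hjk
  set Δ := cross (A - O) (C - O) with hΔ
  -- The weights are the barycentric coordinates of `B` in the triangle `OAC`; the assumed failure
  -- makes the weight of `O` nonnegative.
  refine hq.ne_of_three (v := some j) (a := none) (b := some i) (c := some k) (by simp)
    (by simpa using hji) (by simpa using hjk') (α := 1 - cross (B - O) (C - O) / Δ -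
      cross (A - O) (B - O) / Δ) (β := cross (B - O) (C - O) / Δ) (γ := cross (A - O) (B - O) / Δ)
    ?_ (by positivity) (by positivity) (by ring) ?_
  · rw [sub_sub, ← add_div, sub_nonneg, div_le_one hik]
    linarith
  · rw [← hO, ← hA, ← hB, ← hC]
    have hΔ' := hik.ne'
    apply Complex.ext <;>
    · simp only [Complex.add_re, Complex.add_im, Complex.smul_re, Complex.smul_im, smul_eq_mul]
      field_simp
      simp only [hΔ, cross, Complex.sub_re, Complex.sub_im]
      ring

theorem not_hasConvexOOR_wheelGraph_six {q : Option (Fin 5) → ℂ} (hq : ConvexIndependent ℝ q) :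
    ¬ IsOOR (wheelGraph 6) q := by
  intro hoor
  obtain ⟨f, τ, hf, hτ⟩ := exists_angular_order hq
  obtain ⟨u, v, huv, hadj, hchord⟩ := wheel_chord_search τ
  have hne : some (τ u) ≠ some (τ v) := by simpa using huv.ne
  refine hadj ((hoor.2 _ _ hne).mpr (Set.disjoint_left.mpr ?_))
  rintro x ⟨α, β, hα, hβ, hαβ, rfl⟩
  set x := α • q (some (τ u)) + β • q (some (τ v)) with hx
  set O := q none with hO
  have hnn : ∀ i j, i ≤ j → 0 ≤ cross (q (some (τ i)) - O) (q (some (τ j)) - O) := by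
    intro i j hij
    rcases hij.eq_or_lt with rfl | h
    · rw [cross]; linarith
    · exact (hτ i j h).le
  have htri : ∀ i j k, i ≤ j → j < k →
      0 ≤ cross (q (some (τ j)) - q (some (τ i))) (q (some (τ k)) - q (some (τ i))) := by
    intro i j k hij hjk
    rcases hij.eq_or_lt with rfl | h
    · simp [cross]
    · exact (cross_triangle_pos hq (hτ i j h) (hτ j k hjk) (hτ i k (h.trans hjk))).le
  have hβ' : α = 1 - β := by linarith
  have hlin : ∀ a : ℂ, cross a (x - O) =
      α * cross a (q (some (τ u)) - O) + β * cross a (q (some (τ v)) - O) := by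
    intro a
    simp only [hx, hβ', cross, Complex.sub_re, Complex.sub_im, Complex.add_re, Complex.add_im,
      Complex.smul_re, Complex.smul_im, smul_eq_mul]
    ring
  have hlin' : ∀ a b : ℂ, cross a (x - b) =
      α * cross a (q (some (τ u)) - b) + β * cross a (q (some (τ v)) - b) := by
    intro a b
    simp only [hx, hβ', cross, Complex.sub_re, Complex.sub_im, Complex.add_re, Complex.add_im,
      Complex.smul_re, Complex.smul_im, smul_eq_mul]
    ring
  have hswap : ∀ a b, cross a b = - cross b a := fun a b => by rw [cross, cross]; ring
  have hfx : 0 ≤ f (x - O) := by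
    have : x - O = α • (q (some (τ u)) - O) + β • (q (some (τ v)) - O) := by
      rw [hx, hβ']
      module
    rw [this, map_add, map_smul, map_smul, smul_eq_mul, smul_eq_mul]
    have h1 := hf (τ u)
    have h2 := hf (τ v)
    positivity
  -- `f` applied to the linear relation among three plane vectors. With `f` nonnegative it makes the
  -- angular order transitive.
  have hfid : ∀ a b c : ℂ, f b * cross a c = f a * cross b c + f c * cross a b := by
    intro a b c
    rw [map_eq_re_im f a, map_eq_re_im f b, map_eq_re_im f c]
    simp only [cross]
    ring
  -- `i` is the last position before `v` whose direction is not past `x`, so `x` lies in the angular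
  -- gap following `i`.
  obtain ⟨i, hui, hiv, h1, h2⟩ : ∃ i : Fin 5, u ≤ i ∧ i < v ∧
      0 ≤ cross (q (some (τ i)) - O) (x - O) ∧
      ∀ j, i < j → j ≤ v → 0 ≤ cross (x - O) (q (some (τ j)) - O) := by
    have hS : (Finset.univ.filter fun i : Fin 5 => u ≤ i ∧ i < v ∧
        0 ≤ cross (q (some (τ i)) - O) (x - O)).Nonempty := by
      refine ⟨u, Finset.mem_filter.mpr ⟨Finset.mem_univ _, le_rfl, huv, ?_⟩⟩
      rw [hlin]
      exact add_nonneg (mul_nonneg hα (hnn _ _ le_rfl)) (mul_nonneg hβ (hnn _ _ huv.le))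
    obtain ⟨i, hi, hmax⟩ := Finset.exists_max_image _ id hS
    simp only [Finset.mem_filter, Finset.mem_univ, true_and, id] at hi hmax
    refine ⟨i, hi.1, hi.2.1, hi.2.2, fun j hij hjv => ?_⟩
    rcases hjv.eq_or_lt with rfl | hjv
    · have hself : cross (q (some (τ j)) - O) (q (some (τ j)) - O) = 0 := by rw [cross]; ring
      rw [hswap, hlin, hself, hswap _ (q (some (τ u)) - O)]
      have := mul_nonneg hα (hnn _ _ huv.le)
      linarith
    · by_contra hneg
      rw [hswap] at hneg
      exact absurd (hmax j ⟨hi.1.trans hij.le, hjv, by linarith⟩) (not_le.mpr hij)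
  obtain ⟨a, b, hua, hai, hib, hbv, hab⟩ := hchord i hui hiv
  have hfa := hf (τ a)
  have hfi := hf (τ i)
  refine notMem_outerFace_of_mem_triangle (o := none) (a := some (τ a)) (b := some (τ b))
    trivial trivial hab (hτ a b (hai.trans_lt hib)) ?_ (h2 b hib hbv) ?_
  · have h := hfid (q (some (τ a)) - O) (q (some (τ i)) - O) (x - O)
    have h' : 0 ≤ f (q (some (τ i)) - O) * cross (q (some (τ a)) - O) (x - O) := by
      rw [h]
      exact add_nonneg (mul_nonneg hfa.le h1) (mul_nonneg hfx (hnn _ _ hai))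
    exact nonneg_of_mul_nonneg_right h' hfi
  -- Both ends of the chord, at positions `u ≤ a` and `v ≥ b`, lie weakly on the same side of the
  -- line `ab` as the hub, hence so does `x`.
  · rw [hlin']
    have hab' := hai.trans_lt hib
    refine add_nonneg (mul_nonneg hα ?_) (mul_nonneg hβ ?_)
    · have h := htri u a b hua hab'
      have e : ∀ A B C : ℂ, cross (B - A) (C - A) = cross (C - B) (A - B) := fun A B C => by
        simp only [cross, Complex.sub_re, Complex.sub_im]; ring
      rwa [e] at h
    · rcases hbv.eq_or_lt with rfl | hbv
      · rw [cross]; linarith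
      · exact htri a b v hab'.le hbv

theorem not_hasConvexOOR_of_iso_wheelGraph {V : Type*} {G : SimpleGraph V}
    (h : Nonempty (G ≃g wheelGraph 6)) : ¬ HasConvexOOR G := by
  obtain ⟨e⟩ := h
  rintro ⟨p, hp, hc⟩
  exact not_hasConvexOOR_wheelGraph_six (hc.comp_embedding e.symm.toEquiv.toEmbedding)
    (hp.comp_iso e.symm)

theorem mainTheorem7 {V : Type*} [Fintype V] (G : SimpleGraph V) (hV : Fintype.card V ≤ 6) :
    (HasRegularOOR G ↔ ¬ Nonempty (G ≃g wheelGraph 6)) ∧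
    (Nonempty (G ≃g wheelGraph 6) → ¬ HasConvexOOR G) ∧
    Nonempty (wheelGraph 6 ≃g completeMinusCycle 6 5 (by norm_num)) :=
  ⟨⟨fun h hw => not_hasConvexOOR_of_iso_wheelGraph hw h.hasConvexOOR,
    hasRegularOOR_of_not_iso_wheelGraph G hV⟩,
    not_hasConvexOOR_of_iso_wheelGraph, nonempty_iso_completeMinusCycle⟩
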